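/- Let $G$ be a finitely generated group that is almost abelian, i.e. has an abelian subgroup of finite index, and let $\varphi : G \to G$ be any endomorphism. Call $x, y \in G$ $\varphi$-conjugate if $y = \gamma x \varphi(\gamma)^{-1}$ for some $\gamma \in G$, and let $R(\varphi)$ be the number of $\varphi$-conjugacy classes. Let $\hat G$ be the unitary dual of $G$, i.e. the set of unitary equivalence classes of irreducible unitary representations of the discrete group $G$ on non-zero complex Hilbert spaces (of any dimension), and let $\hat\varphi$ be the map induced by $\rho \mapsto \rho \circ \varphi$ on equivalence classes of unitary representations. Let $\#\mathrm{Fix}(\hat\varphi)$ be the number of fixed points of $\hat\varphi$ in $\hat G$, i.e. the number of classes of irreducible unitary representations $\rho$ for which $\rho \circ \varphi$ is unitarily equivalent to $\rho$. If $R(\varphi)$ is finite, then $\#\mathrm{Fix}(\hat\varphi)$ is finite and $$R(\varphi) = \#\mathrm{Fix}(\hat\varphi).$$ -/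

import Mathlib

universe u v

/-- `x` and `y` are `φ`-conjugate if `y = γ x φ(γ)⁻¹` for some `γ`. -/
def twistedConjSetoid {G : Type u} [Group G] (φ : G →* G) : Setoid G where
  r x y := ∃ γ : G, y = γ * x * (φ γ)⁻¹
  iseqv :=
    { refl := fun x => ⟨1, by simp⟩
      symm := by
        rintro x y ⟨γ, rfl⟩
        exact ⟨γ⁻¹, by simp [mul_assoc]⟩
      trans := by
        rintro x y z ⟨γ, rfl⟩ ⟨δ, rfl⟩
        exact ⟨δ * γ, by simp [mul_assoc]⟩ }

/-- The set of `φ`-conjugacy classes. -/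
abbrev ReidemeisterClass {G : Type u} [Group G] (φ : G →* G) : Type u :=
  Quotient (twistedConjSetoid φ)

/-- The Reidemeister number `R(φ)`, the number of `φ`-conjugacy classes (possibly `⊤`). -/
noncomputable def reidemeisterNumber {G : Type u} [Group G] (φ : G →* G) : ℕ∞ :=
  ENat.card (ReidemeisterClass φ)

/-- A group is almost abelian if it has an abelian subgroup of finite index. -/
def IsAlmostAbelian (G : Type u) [Group G] : Prop :=
  ∃ A : Subgroup G, (∀ a ∈ A, ∀ b ∈ A, a * b = b * a) ∧ A.FiniteIndex

/-- A unitary representation of the (discrete) group `G` on a complex Hilbert space. -/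
structure UnitaryRep (G : Type u) [Group G] : Type (max u (v + 1)) where
  /-- The Hilbert space. -/
  V : Type v
  [instNormed : NormedAddCommGroup V]
  [instInner : InnerProductSpace ℂ V]
  [instComplete : CompleteSpace V]
  /-- The homomorphism into the unitary group of the Hilbert space. -/
  ρ : G →* (V ≃ₗᵢ[ℂ] V)

attribute [instance] UnitaryRep.instNormed UnitaryRep.instInner UnitaryRep.instComplete

namespace UnitaryRep

variable {G : Type u} [Group G]

/-- Unitary equivalence: a Hilbert space isomorphism commuting with the actions of `G`. -/
def Equivalent (π σ : UnitaryRep.{u, v} G) : Prop :=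
  ∃ T : π.V ≃ₗᵢ[ℂ] σ.V, ∀ (g : G) (x : π.V), T (π.ρ g x) = σ.ρ g (T x)

/-- The space is non-zero and has no closed invariant subspaces besides `0` and itself. -/
def IsIrreducible (π : UnitaryRep.{u, v} G) : Prop :=
  Nontrivial π.V ∧
    ∀ W : Submodule ℂ π.V, IsClosed (W : Set π.V) →
      (∀ (g : G), ∀ x ∈ W, π.ρ g x ∈ W) → W = ⊥ ∨ W = ⊤

/-- The representation `ρ ∘ φ`. -/
def comp (φ : G →* G) (π : UnitaryRep.{u, v} G) : UnitaryRep.{u, v} G where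
  V := π.V
  ρ := π.ρ.comp φ

theorem Equivalent.comp {π σ : UnitaryRep.{u, v} G} (φ : G →* G) (h : π.Equivalent σ) :
    (UnitaryRep.comp φ π).Equivalent (UnitaryRep.comp φ σ) := by
  obtain ⟨T, hT⟩ := h
  exact ⟨T, fun g x => hT (φ g) x⟩

/-- Unitary equivalence as an equivalence relation. -/
instance setoid (G : Type u) [Group G] : Setoid (UnitaryRep.{u, v} G) where
  r := Equivalent
  iseqv :=
    { refl := fun π => ⟨LinearIsometryEquiv.refl ℂ π.V, fun _ _ => rfl⟩
      symm := by
        rintro π σ ⟨T, hT⟩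
        refine ⟨T.symm, fun g x => ?_⟩
        apply T.injective
        simp [hT]
      trans := by
        rintro π σ τ ⟨T, hT⟩ ⟨S, hS⟩
        exact ⟨T.trans S, fun g x => by simp [hT, hS]⟩ }

end UnitaryRep

/-- Equivalence classes of all unitary representations of `G`. -/
abbrev UnitaryRepClass (G : Type u) [Group G] : Type (max u (v + 1)) :=
  Quotient (UnitaryRep.setoid.{u, v} G)

/-- The unitary dual: the set of equivalence classes of irreducible unitary representations. -/
def unitaryDual (G : Type u) [Group G] : Set (UnitaryRepClass.{u, v} G) :=
  {c | ∃ π : UnitaryRep.{u, v} G, π.IsIrreducible ∧ ⟦π⟧ = c}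

/-- The map `[ρ] ↦ [ρ ∘ φ]`. It is defined on all classes of unitary representations, because
`ρ ∘ φ` can be reducible for an irreducible `ρ` when `φ` is not surjective. -/
def dualMap {G : Type u} [Group G] (φ : G →* G) :
    UnitaryRepClass.{u, v} G → UnitaryRepClass.{u, v} G :=
  Quotient.map (UnitaryRep.comp φ) (fun _ _ h => UnitaryRep.Equivalent.comp φ h)

/-- The points of the unitary dual that are fixed by the induced map: the classes of the
irreducible unitary representations `ρ` with `ρ ∘ φ` equivalent to `ρ`. -/
def dualFixedPoints {G : Type u} [Group G] (φ : G →* G) : Set (UnitaryRepClass.{u, v} G) :=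
  {c | c ∈ unitaryDual.{u, v} G ∧ dualMap φ c = c}

/-- The number of fixed points of the induced map on the unitary dual (possibly `⊤`). -/
noncomputable def numDualFixedPoints {G : Type u} [Group G] (φ : G →* G) : ℕ∞ :=
  Set.encard (dualFixedPoints.{u, v} φ)

/-! Both counts are transported to a finite quotient `G ⧸ N` and compared there.

The subgroup `N` comes from a pigeonhole argument. Let `B` be abelian, normal, `φ`-invariant and of
finite index. As `R(φ)` is finite, `B` has finitely many twisted orbits on `G`, so two of the
elements `g * b ^ k` lie in one orbit. Commutativity of `B` turns this into a fixed power `m`, the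
same for all `g` and `b`, such that `g * b ^ m` is `φ`-conjugate to `g`
(`exists_pow_twisted_coboundary`). A subgroup generated by suitable powers then has every coset
inside one `φ`-class, so `R(φ)` does not change on passing to `G ⧸ N`.

On the dual side, irreducible representations of `G` are finite-dimensional. If `t` intertwines `ρ`
with `ρ ∘ φ`, then `x ↦ tr (t ρ(x))` is constant on `φ`-classes, hence unchanged under `x ↦ x * n`
for `n ∈ N`; as the `ρ(x)` span all operators, `ρ(n) = 1`. So every fixed point is inflated from `G
⧸ N`.

For a finite group `H`, a functional on `ℂ[H] ≅ ∏ M_{d_i}` has the form `X ↦ ∑ tr (T_i X_i)`, and it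
is a `φ`-class function exactly when each `T_i` intertwines `ρ_i` with `ρ_i ∘ φ`. By Schur each
block contributes dimension 1 or 0, according to whether `ρ_i` is fixed, so `R(φ)` is the number of
fixed blocks. -/

/-! ### Subgroups generated by powers -/

/-- The subgroup generated by the `n`-th powers. -/
def powSubgroup (G : Type u) [Group G] (n : ℕ) : Subgroup G :=
  Subgroup.closure (Set.range fun g : G => g ^ n)

namespace powSubgroup

variable {G : Type u} [Group G]

theorem pow_mem (n : ℕ) (g : G) : g ^ n ∈ powSubgroup G n :=
  Subgroup.subset_closure ⟨g, rfl⟩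

theorem le_comap (n : ℕ) (φ : G →* G) : powSubgroup G n ≤ (powSubgroup G n).comap φ := by
  refine (Subgroup.closure_le _).2 ?_
  rintro _ ⟨g, rfl⟩
  simpa using pow_mem n (φ g)

instance normal (n : ℕ) : (powSubgroup G n).Normal :=
  ⟨fun x hx g => by simpa using le_comap n (MulAut.conj g).toMonoidHom hx⟩

theorem le_of_index (A : Subgroup G) [A.Normal] : powSubgroup G A.index ≤ A := by
  refine (Subgroup.closure_le _).2 ?_
  rintro _ ⟨g, rfl⟩
  exact A.pow_index_mem g

/-- For `A` abelian of finite index, `A / A ^ n` is a finitely generated torsion abelian group,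
hence finite, and `A ^ n` lies in the power subgroup. -/
theorem finiteIndex (hfg : Group.FG G) (hG : IsAlmostAbelian G) {n : ℕ} (hn : n ≠ 0) :
    (powSubgroup G n).FiniteIndex := by
  obtain ⟨A, hA, hAi⟩ := hG
  let _ : CommGroup A := { mul_comm := fun a b => Subtype.ext (hA a a.2 b b.2) }
  have : Group.FG A := Subgroup.fg_of_index_ne_zero A
  let K : Subgroup A := (powMonoidHom n : A →* A).range
  have hfin : Finite (A ⧸ K) := by
    apply CommGroup.finite_of_fg_isMulTorsion
    intro x
    induction x using QuotientGroup.induction_on with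
    | H a =>
      refine isOfFinOrder_iff_pow_eq_one.2 ⟨n, Nat.pos_of_ne_zero hn, ?_⟩
      rw [← QuotientGroup.mk_pow, QuotientGroup.eq_one_iff]
      exact ⟨a, rfl⟩
  have hK : K.FiniteIndex := Subgroup.finiteIndex_of_finite_quotient
  have hKA : (K.map A.subtype).FiniteIndex := by
    constructor
    rw [Subgroup.index_map_subtype]
    exact mul_ne_zero hK.index_ne_zero hAi.index_ne_zero
  refine Subgroup.finiteIndex_of_le (H := K.map A.subtype) ?_
  rintro _ ⟨_, ⟨a, rfl⟩, rfl⟩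
  exact pow_mem n (a : G)

end powSubgroup

theorem exists_normal_abelian_finiteIndex {G : Type u} [Group G] (hG : IsAlmostAbelian G) :
    ∃ A : Subgroup G, A.Normal ∧ (∀ a ∈ A, ∀ b ∈ A, a * b = b * a) ∧ A.FiniteIndex := by
  obtain ⟨A, hA, hAi⟩ := hG
  exact ⟨A.normalCore, inferInstance,
    fun a ha b hb => hA a (A.normalCore_le ha) b (A.normalCore_le hb), inferInstance⟩

/-! ### Reidemeister classes and reduction to a finite quotient -/

section Separation

variable {G : Type u} [Group G] (φ : G →* G)

/-- If there are finitely many `φ`-classes, then a finite index subgroup has finitely many orbits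
for its twisted conjugation action. -/
theorem exists_finite_twisted_representatives [Finite (ReidemeisterClass φ)] (B : Subgroup G)
    [B.FiniteIndex] :
    ∃ S : Set G, S.Finite ∧ ∀ x : G, ∃ s ∈ S, ∃ b ∈ B, x = b * s * (φ b)⁻¹ := by
  have : Finite (G ⧸ B) := Subgroup.finite_quotient_of_finiteIndex
  refine ⟨Set.range fun p : ReidemeisterClass φ × (G ⧸ B) =>
    p.2.out⁻¹ * p.1.out * (φ p.2.out⁻¹)⁻¹, Set.finite_range _, fun x => ?_⟩
  obtain ⟨γ, hγ⟩ : ∃ γ : G, x = γ * (⟦x⟧ : ReidemeisterClass φ).out * (φ γ)⁻¹ :=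
    Quotient.exact (s := twistedConjSetoid φ) (Quotient.out_eq _)
  -- With `q` the representative of `γ⁻¹B`, write `γ = (γ * q) * q⁻¹`; the factor `γ * q` lies in
  -- `B`.
  refine ⟨_, ⟨(⟦x⟧, ((γ⁻¹ : G) : G ⧸ B)), rfl⟩, γ * ((γ⁻¹ : G) : G ⧸ B).out, ?_, ?_⟩
  · have := QuotientGroup.eq.1 (QuotientGroup.out_eq' ((γ⁻¹ : G) : G ⧸ B)).symm
    simpa using this
  · conv_lhs => rw [hγ]
    simp [mul_assoc]

theorem exists_pow_twisted_coboundary [Finite (ReidemeisterClass φ)] (B : Subgroup G) [B.Normal]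
    (hB : ∀ a ∈ B, ∀ b ∈ B, a * b = b * a) [B.FiniteIndex] (hφ : B ≤ B.comap φ) :
    ∃ m : ℕ, m ≠ 0 ∧ ∀ g : G, ∀ b ∈ B, ∃ γ : G, g * b ^ m = γ * g * (φ γ)⁻¹ := by
  obtain ⟨S, hS, hrep⟩ := exists_finite_twisted_representatives φ B
  -- Pigeonhole gives a difference `l - k` between 1 and `|S|` depending on `g` and `b`; the
  -- factorial is a common multiple of all of them.
  refine ⟨(hS.toFinset.card).factorial, Nat.factorial_ne_zero _, fun g b hb => ?_⟩
  choose s hs c hcB hc using hrep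
  obtain ⟨k, hk, l, hl, hkl, hskl⟩ := Finset.exists_ne_map_eq_of_card_lt_of_maps_to
    (s := Finset.range (hS.toFinset.card + 1)) (t := hS.toFinset) (by simp)
    (f := fun k => s (g * b ^ k)) (fun k _ => by simpa using hs _)
  wlog hlt : k < l generalizing k l
  · exact this l hl k hk hkl.symm hskl.symm (lt_of_le_of_ne (not_lt.1 hlt) hkl.symm)
  simp only [Finset.mem_range] at hl
  have hk' := hc (g * b ^ k)
  have hl' := hc (g * b ^ l)
  rw [hskl] at hk'
  set β := c (g * b ^ l) * (c (g * b ^ k))⁻¹ with hβ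
  have hβB : β ∈ B := B.mul_mem (hcB _) (B.inv_mem (hcB _))
  have h1 : g * b ^ l = β * (g * b ^ k) * (φ β)⁻¹ := by
    rw [hk', hβ]
    conv_lhs => rw [hl']
    simp [mul_assoc]
  have hgβ (x : G) (hx : x ∈ B) : g⁻¹ * x * g ∈ B := by
    simpa using Subgroup.Normal.conj_mem inferInstance x hx g⁻¹
  have h2 : b ^ (l - k) = (g⁻¹ * β * g) * (φ β)⁻¹ := by
    have hcomm := hB (b ^ k) (B.pow_mem hb k) (φ β)⁻¹ (B.inv_mem (hφ hβB))
    have : b ^ l = b ^ (l - k) * b ^ k := by rw [← pow_add, Nat.sub_add_cancel hlt.le]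
    rw [this] at h1
    have h3 : g * b ^ (l - k) * b ^ k = β * g * (φ β)⁻¹ * b ^ k := by
      rw [mul_assoc g, h1]
      simp only [mul_assoc, hcomm]
    have h4 := mul_right_cancel h3
    rw [← mul_right_inj g, h4]
    simp [mul_assoc]
  obtain ⟨j, hj⟩ : l - k ∣ (hS.toFinset.card).factorial :=
    Nat.dvd_factorial (by omega) (by omega)
  refine ⟨β ^ j, ?_⟩
  -- Both factors of `b ^ (l - k)` lie in the abelian group `B`, so its `j`-th power has the same
  -- shape, with `β ^ j` for `β`.
  have hcomm : Commute (g⁻¹ * β * g) (φ β)⁻¹ := hB _ (hgβ _ hβB) _ (B.inv_mem (hφ hβB))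
  rw [hj, pow_mul, h2, hcomm.mul_pow]
  have : (g⁻¹ * β * g) ^ j = g⁻¹ * β ^ j * g := by simpa using conj_pow (a := g⁻¹) (b := β) (i := j)
  rw [this]
  simp [mul_assoc]

/-- A finite Reidemeister number is detected on a finite quotient. -/
theorem exists_finiteIndex_separating [Finite (ReidemeisterClass φ)] (hfg : Group.FG G)
    (hG : IsAlmostAbelian G) :
    ∃ N : Subgroup G, N.Normal ∧ N.FiniteIndex ∧ N ≤ N.comap φ ∧
      ∀ x : G, ∀ n ∈ N, ∃ γ : G, x * n = γ * x * (φ γ)⁻¹ := by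
  obtain ⟨A, hAn, hA, hAi⟩ := exists_normal_abelian_finiteIndex hG
  -- `A` need not be `φ`-invariant; the power subgroup inside it is invariant under every
  -- endomorphism.
  set B := powSubgroup G A.index
  have hBA : B ≤ A := powSubgroup.le_of_index A
  have : B.FiniteIndex := powSubgroup.finiteIndex hfg hG hAi.index_ne_zero
  obtain ⟨m, hm, h⟩ := exists_pow_twisted_coboundary φ B
    (fun a ha b hb => hA a (hBA ha) b (hBA hb)) (powSubgroup.le_comap _ φ)
  -- A generator `g ^ (A.index * m)` is the `m`-th power of an element of `B`.
  refine ⟨powSubgroup G (A.index * m), inferInstance,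
    powSubgroup.finiteIndex hfg hG (mul_ne_zero hAi.index_ne_zero hm),
    powSubgroup.le_comap _ φ, fun x n hn => ?_⟩
  change twistedConjSetoid φ x (x * n)
  induction hn using Subgroup.closure_induction generalizing x with
  | mem n hn =>
    obtain ⟨g, rfl⟩ := hn
    simp only [pow_mul]
    exact h x _ (powSubgroup.pow_mem _ g)
  | one =>
    rw [mul_one]

  | mul a b _ _ ha hb =>
    rw [← mul_assoc]
    exact (twistedConjSetoid φ).trans (ha x) (hb (x * a))
  | inv a _ ha => simpa using (twistedConjSetoid φ).symm (ha (x * a⁻¹))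

theorem reidemeisterNumber_quotient (N : Subgroup G) [N.Normal] (hφ : N ≤ N.comap φ)
    (h : ∀ x : G, ∀ n ∈ N, ∃ γ : G, x * n = γ * x * (φ γ)⁻¹) :
    reidemeisterNumber φ = reidemeisterNumber (QuotientGroup.map N N φ hφ) := by
  let f : ReidemeisterClass φ → ReidemeisterClass (QuotientGroup.map N N φ hφ) :=
    Quotient.map (fun x : G => (x : G ⧸ N)) (by
      rintro x _ ⟨γ, rfl⟩
      exact ⟨γ, by simp⟩)
  refine ENat.card_congr (Equiv.ofBijective f ⟨?_, ?_⟩)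
  · intro a b
    induction a using Quotient.inductionOn
    induction b using Quotient.inductionOn
    rename_i x y
    intro hxy
    obtain ⟨γ, hγ⟩ : ∃ γ : G ⧸ N, (y : G ⧸ N) = γ * x * (QuotientGroup.map N N φ hφ γ)⁻¹ :=
      Quotient.exact (s := twistedConjSetoid (QuotientGroup.map N N φ hφ)) hxy
    induction γ using QuotientGroup.induction_on with
    | H γ =>
      have hn : (γ * x * (φ γ)⁻¹)⁻¹ * y ∈ N := QuotientGroup.eq.1 (by simpa using hγ.symm)
      refine Quotient.sound (s := twistedConjSetoid φ)
        ((twistedConjSetoid φ).trans (b := γ * x * (φ γ)⁻¹) ⟨γ, rfl⟩ ?_)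
      have := h (γ * x * (φ γ)⁻¹) _ hn
      rwa [mul_inv_cancel_left] at this
  · intro b
    induction b using Quotient.inductionOn
    rename_i y
    induction y using QuotientGroup.induction_on with
    | H y => exact ⟨Quotient.mk _ y, rfl⟩

end Separation

/-! ### Finite groups: twisted class functions and Wedderburn blocks -/

section Wedderburn

/-- Maschke and Wedderburn over `ℂ`. The index types are lifted to universe `v`, where the Hilbert
spaces of the unitary dual live. -/
theorem exists_groupAlgebra_algEquiv_pi_matrix (H : Type u) [Group H] [Finite H] :
    ∃ (n : ℕ) (ι : Fin n → Type v) (_ : ∀ i, Fintype (ι i)) (_ : ∀ i, DecidableEq (ι i)),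
      (∀ i, Nonempty (ι i)) ∧
      Nonempty (MonoidAlgebra ℂ H ≃ₐ[ℂ] Π i, Matrix (ι i) (ι i) ℂ) := by
  have : FiniteDimensional ℂ (MonoidAlgebra ℂ H) :=
    Module.Finite.of_basis (MonoidAlgebra.basis H ℂ)
  have : NeZero (Nat.card H : ℂ) := ⟨by exact_mod_cast Nat.card_pos.ne'⟩
  obtain ⟨n, d, hd, ⟨e⟩⟩ :=
    IsSemisimpleRing.exists_algEquiv_pi_matrix_of_isAlgClosed ℂ (MonoidAlgebra ℂ H)
  exact ⟨n, fun i => ULift.{v} (Fin (d i)), inferInstance, inferInstance, fun i => inferInstance,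
    ⟨e.trans (AlgEquiv.piCongrRight fun i =>
      Matrix.reindexAlgEquiv ℂ ℂ (Equiv.ulift.symm : Fin (d i) ≃ ULift.{v} (Fin (d i))))⟩⟩

variable {H : Type u} [Group H] {I : Type*} {ι : I → Type v}
  [∀ i, Fintype (ι i)] [∀ i, DecidableEq (ι i)]
  (e : MonoidAlgebra ℂ H ≃ₐ[ℂ] Π i, Matrix (ι i) (ι i) ℂ)

/-- The matrix representation of the group on a block of its group algebra. -/
noncomputable def blockRep (i : I) : H →* Matrix (ι i) (ι i) ℂ :=
  ((Pi.evalMonoidHom _ i).comp (e : _ →* Π i, Matrix (ι i) (ι i) ℂ)).comp (MonoidAlgebra.of ℂ H)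

theorem blockRep_apply (i : I) (h : H) : blockRep e i h = e (MonoidAlgebra.of ℂ H h) i := rfl

/-- Two linear maps on a product of matrix algebras that agree on the group agree. -/
theorem pi_matrix_linearMap_ext {M : Type*} [AddCommMonoid M] [Module ℂ M]
    {f g : (Π i, Matrix (ι i) (ι i) ℂ) →ₗ[ℂ] M}
    (h : ∀ x : H, f (fun i => blockRep e i x) = g (fun i => blockRep e i x)) : f = g := by
  have : f ∘ₗ e.toLinearMap = g ∘ₗ e.toLinearMap := (MonoidAlgebra.basis H ℂ).ext fun x => h x
  refine LinearMap.ext fun x => ?_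
  simpa using LinearMap.congr_fun this (e.symm x)

/-- The group spans the whole product, hence each block. This plays the role of irreducibility of
the blocks. -/
theorem matrix_linearMap_ext {M : Type*} [AddCommMonoid M] [Module ℂ M] (i : I)
    {f g : Matrix (ι i) (ι i) ℂ →ₗ[ℂ] M}
    (h : ∀ x : H, f (blockRep e i x) = g (blockRep e i x)) : f = g := by
  classical
  have := pi_matrix_linearMap_ext e (f := f ∘ₗ LinearMap.proj i) (g := g ∘ₗ LinearMap.proj i) h
  refine LinearMap.ext fun x => ?_
  simpa using LinearMap.congr_fun this (Pi.single i x)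

variable (φ : H →* H)

/-- The matrices intertwining a block with its pullback along `φ`. -/
def blockIntertwiners (i : I) : Submodule ℂ (Matrix (ι i) (ι i) ℂ) where
  carrier := {T | ∀ h : H, T * blockRep e i h = blockRep e i (φ h) * T}
  add_mem' := by
    intro a b ha hb h
    rw [add_mul, mul_add, ha h, hb h]
  zero_mem' := by simp
  smul_mem' := by
    intro c a ha h
    rw [smul_mul_assoc, mul_smul_comm, ha h]

variable {e φ}

/-- A nonzero intertwiner of a block with its pullback along `φ` is invertible. -/
theorem isUnit_of_mem_blockIntertwiners {i : I} {T : Matrix (ι i) (ι i) ℂ}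
    (hT : T ∈ blockIntertwiners e φ i) (h0 : T ≠ 0) : IsUnit T := by
  rw [← Matrix.mulVec_injective_iff_isUnit]
  by_contra hinj
  obtain ⟨v, hv, hv0⟩ : ∃ v, T.mulVec v = 0 ∧ v ≠ 0 := by
    by_contra! hcon
    exact hinj ((injective_iff_map_eq_zero T.mulVecLin).2 hcon)
  -- The kernel of `T` is stable under the block, hence under all matrices; this does not need the
  -- pullback to be irreducible.
  have key : ∀ X : Matrix (ι i) (ι i) ℂ, (T * X).mulVec v = 0 := by
    let f : Matrix (ι i) (ι i) ℂ →ₗ[ℂ] (ι i → ℂ) :=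
      { toFun := fun X => (T * X).mulVec v
        map_add' := by intro X Y; simp [mul_add, Matrix.add_mulVec]
        map_smul' := by intro c X; simp [Matrix.smul_mulVec] }
    have : f = 0 := matrix_linearMap_ext e i fun x => by
      change (T * _).mulVec v = 0
      rw [hT x, ← Matrix.mulVec_mulVec, hv, Matrix.mulVec_zero]
    exact fun X => LinearMap.congr_fun this X
  obtain ⟨j, hj⟩ := Function.ne_iff.1 hv0
  apply h0
  ext a b
  -- This matrix sends `v` to the basis vector at `b`.
  have := congrFun (key (Matrix.single b j (v j)⁻¹)) a
  rw [← Matrix.mulVec_mulVec, Matrix.single_mulVec] at this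
  simpa [hj, show v j ≠ 0 from hj, Matrix.mulVec, dotProduct, Function.update_apply] using this

/-- Schur: for an invertible intertwiner `U` and any other `S`, the matrix `U⁻¹ * S` commutes with
the whole block, so it is scalar. -/
theorem finrank_blockIntertwiners (i : I) [Decidable (blockIntertwiners e φ i = ⊥)]
    [Nonempty (ι i)] :
    Module.finrank ℂ (blockIntertwiners e φ i) = if blockIntertwiners e φ i = ⊥ then 0 else 1 := by
  split_ifs with h
  · rw [h, finrank_bot]
  · obtain ⟨T, hT, h0⟩ := (Submodule.ne_bot_iff _).1 h
    obtain ⟨U, rfl⟩ := isUnit_of_mem_blockIntertwiners hT h0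
    refine finrank_eq_one (⟨U, hT⟩ : blockIntertwiners e φ i) (by simp) ?_
    rintro ⟨S, hS⟩
    set Y : Matrix (ι i) (ι i) ℂ := (↑U⁻¹ : Matrix (ι i) (ι i) ℂ) * S with hY
    have hc : LinearMap.mulRight ℂ Y = LinearMap.mulLeft ℂ Y :=
      matrix_linearMap_ext e i fun x => by
        simp only [LinearMap.mulRight_apply, LinearMap.mulLeft_apply]
        rw [hY, mul_assoc, hS x, ← mul_assoc, ← mul_assoc]
        congr 1
        rw [Units.eq_inv_mul_iff_mul_eq, ← mul_assoc, hT x, mul_assoc, Units.mul_inv, mul_one]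
    obtain ⟨c, hc⟩ : Y ∈ Set.range (Matrix.scalar (ι i)) :=
      Matrix.mem_range_scalar_iff_commute_single'.2 fun a b => LinearMap.congr_fun hc _
    refine ⟨c, Subtype.ext ?_⟩
    have : S = U * Y := by rw [hY, Units.mul_inv_cancel_left]
    change c • (U : Matrix (ι i) (ι i) ℂ) = S
    rw [this, ← hc, Matrix.scalar_apply, ← Matrix.smul_one_eq_diagonal, mul_smul_comm, mul_one]

theorem symm_single_blockRep_mul [DecidableEq I] (i : I) (X : Matrix (ι i) (ι i) ℂ) (h : H) :
    e.symm (Pi.single i (blockRep e i h * X)) =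
      MonoidAlgebra.of ℂ H h * e.symm (Pi.single i X) := by
  apply e.injective
  rw [map_mul, e.apply_symm_apply, e.apply_symm_apply]
  funext j
  obtain rfl | hj := eq_or_ne j i
  · simp [blockRep_apply]
  · simp [hj]

theorem symm_single_mul_blockRep [DecidableEq I] (i : I) (X : Matrix (ι i) (ι i) ℂ) (h : H) :
    e.symm (Pi.single i (X * blockRep e i h)) =
      e.symm (Pi.single i X) * MonoidAlgebra.of ℂ H h := by
  apply e.injective
  rw [map_mul, e.apply_symm_apply, e.apply_symm_apply]
  funext j
  obtain rfl | hj := eq_or_ne j i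
  · simp [blockRep_apply]
  · simp [hj]

variable [Fintype I]

variable (e φ)

/-- The functions on `φ`-conjugacy classes are the sums of the twisted traces of the blocks. -/
noncomputable def twistedTrace :
    (Π i, blockIntertwiners e φ i) →ₗ[ℂ] (ReidemeisterClass φ → ℂ) where
  toFun T := Quotient.lift (fun x : H => ∑ i, (((T i : Matrix (ι i) (ι i) ℂ)) * blockRep e i x).trace)
    (by
      rintro x _ ⟨γ, rfl⟩
      refine Finset.sum_congr rfl fun i _ => ?_
      have hφ : blockRep e i (φ γ)⁻¹ * blockRep e i (φ γ) = 1 := by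
        rw [← map_mul, inv_mul_cancel, map_one]
      rw [map_mul, map_mul, ← mul_assoc, ← mul_assoc, (T i).2 γ, Matrix.trace_mul_comm _ (blockRep e i (φ γ)⁻¹),
        ← mul_assoc, ← mul_assoc, hφ, one_mul])
  map_add' S T := by
    ext c
    induction c using Quotient.inductionOn
    simp [add_mul, Finset.sum_add_distrib]
  map_smul' a T := by
    ext c
    induction c using Quotient.inductionOn
    simp [Finset.mul_sum]

theorem twistedTrace_apply (T : Π i, blockIntertwiners e φ i) (x : H) :
    twistedTrace e φ T ⟦x⟧ = ∑ i, (((T i : Matrix (ι i) (ι i) ℂ)) * blockRep e i x).trace := rfl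

/-- The group spans the product of blocks, and the trace form is nondegenerate on each block. -/
theorem twistedTrace_injective : Function.Injective (twistedTrace e φ) := by
  classical
  refine (injective_iff_map_eq_zero _).2 fun T hT => ?_
  let f : (Π i, Matrix (ι i) (ι i) ℂ) →ₗ[ℂ] ℂ :=
    ∑ i, Matrix.traceLinearMap _ ℂ ℂ ∘ₗ LinearMap.mulLeft ℂ (T i : Matrix (ι i) (ι i) ℂ) ∘ₗ
      LinearMap.proj i
  have hfa (X) : f X = ∑ i, ((T i : Matrix (ι i) (ι i) ℂ) * X i).trace := by simp [f]
  have hf : f = 0 := pi_matrix_linearMap_ext e fun x => by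
    rw [hfa, ← twistedTrace_apply, hT]
    rfl
  funext i
  refine Subtype.ext (Matrix.ext_iff_trace_mul_right.2 fun X => ?_)
  have := LinearMap.congr_fun hf (Pi.single i X)
  rw [hfa, Finset.sum_eq_single i (fun j _ hj => by simp [Pi.single_eq_of_ne hj]) (by simp)] at this
  simpa using this

/-- Extend `f` linearly to `l` on the group algebra and represent `l` on each block by the trace
form. Invariance on classes reads `l (γ x) = l (x φ(γ))`, which by nondegeneracy says that the
representing matrices are intertwiners. -/
theorem twistedTrace_surjective : Function.Surjective (twistedTrace e φ) := by
  classical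
  intro f
  let l : MonoidAlgebra ℂ H →ₗ[ℂ] ℂ := (MonoidAlgebra.basis H ℂ).constr ℂ fun h => f ⟦h⟧
  have hl (h : H) : l (MonoidAlgebra.of ℂ H h) = f ⟦h⟧ :=
    (MonoidAlgebra.basis H ℂ).constr_basis ℂ (fun h => f ⟦h⟧) h
  -- The indices are swapped because `tr (T * E_{ba}) = T_{ab}`.
  let T (i : I) : Matrix (ι i) (ι i) ℂ :=
    Matrix.of fun a b => l (e.symm (Pi.single i (Matrix.single b a 1)))
  have hT (i : I) (X : Matrix (ι i) (ι i) ℂ) : (T i * X).trace = l (e.symm (Pi.single i X)) := by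
    let p : Matrix (ι i) (ι i) ℂ →ₗ[ℂ] ℂ := Matrix.traceLinearMap _ ℂ ℂ ∘ₗ LinearMap.mulLeft ℂ (T i)
    let q : Matrix (ι i) (ι i) ℂ →ₗ[ℂ] ℂ :=
      l ∘ₗ e.symm.toLinearMap ∘ₗ LinearMap.single ℂ (fun i => Matrix (ι i) (ι i) ℂ) i
    have : p = q := (Matrix.stdBasis ℂ (ι i) (ι i)).ext fun ab => by
      rcases ab with ⟨a, b⟩
      simp [p, q, Matrix.stdBasis_eq_single, T, Matrix.trace_mul_single]
    exact LinearMap.congr_fun this X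
  have hclass (γ : H) (x : MonoidAlgebra ℂ H) :
      l (MonoidAlgebra.of ℂ H γ * x) = l (x * MonoidAlgebra.of ℂ H (φ γ)) := by
    have : l ∘ₗ LinearMap.mulLeft ℂ (MonoidAlgebra.of ℂ H γ) =
        l ∘ₗ LinearMap.mulRight ℂ (MonoidAlgebra.of ℂ H (φ γ)) :=
      (MonoidAlgebra.basis H ℂ).ext fun h => by
        change l (MonoidAlgebra.of ℂ H γ * MonoidAlgebra.of ℂ H h) =
          l (MonoidAlgebra.of ℂ H h * MonoidAlgebra.of ℂ H (φ γ))
        rw [← map_mul, ← map_mul, hl, hl]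
        congr 1
        refine (Quotient.sound (s := twistedConjSetoid φ) ⟨γ, ?_⟩).symm
        simp [mul_assoc]
    exact LinearMap.congr_fun this x
  refine ⟨fun i => ⟨T i, fun γ => Matrix.ext_iff_trace_mul_right.2 fun X => ?_⟩, ?_⟩
  · rw [mul_assoc, hT, symm_single_blockRep_mul, hclass, ← symm_single_mul_blockRep, ← hT, mul_assoc (blockRep e i (φ γ)),
      Matrix.trace_mul_comm (blockRep e i (φ γ)), mul_assoc]
  · ext c
    induction c using Quotient.inductionOn with
    | h x =>
      rw [twistedTrace_apply, ← hl, ← e.symm_apply_apply (MonoidAlgebra.of ℂ H x),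
        ← Finset.univ_sum_single (e (MonoidAlgebra.of ℂ H x)), map_sum, map_sum]
      exact Finset.sum_congr rfl fun i _ => hT i _

theorem card_reidemeisterClass [Finite H] [∀ i, Nonempty (ι i)] :
    Nat.card (ReidemeisterClass φ) = Nat.card {i : I // blockIntertwiners e φ i ≠ ⊥} := by
  classical
  have : Fintype (ReidemeisterClass φ) := Fintype.ofFinite _
  have h := (LinearEquiv.ofBijective (twistedTrace e φ)
    ⟨twistedTrace_injective e φ, twistedTrace_surjective e φ⟩).finrank_eq
  rw [Module.finrank_pi_fintype, Module.finrank_fintype_fun_eq_card] at h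
  rw [Nat.card_eq_fintype_card, ← h, Nat.card_eq_fintype_card, Fintype.card_subtype,
    Finset.card_filter]
  refine Finset.sum_congr rfl fun i _ => ?_
  rw [finrank_blockIntertwiners]
  split_ifs <;> simp_all

end Wedderburn

/-! ### Schur's lemma in arbitrary dimension -/

namespace UnitaryRep

variable {G : Type u} [Group G]

/-- The action of a group element as a bounded operator. -/
noncomputable def op (π : UnitaryRep.{u, v} G) : G →* (π.V →L[ℂ] π.V) where
  toFun g := (π.ρ g : π.V →L[ℂ] π.V)
  map_one' := by ext; simp
  map_mul' a b := by ext; simp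

variable {π σ : UnitaryRep.{u, v} G}

@[simp]
theorem op_apply (g : G) (x : π.V) : π.op g x = π.ρ g x := rfl

theorem star_op (g : G) : star (π.op g) = π.op g⁻¹ := by
  have h : star (π.op g) * π.op g = 1 :=
    (Unitary.linearIsometryEquiv.symm (π.ρ g)).2.1
  calc star (π.op g) = star (π.op g) * (π.op g * π.op g⁻¹) := by
        rw [← map_mul, mul_inv_cancel, map_one, mul_one]
    _ = π.op g⁻¹ := by rw [← mul_assoc, h, one_mul]

theorem commute_star {S : π.V →L[ℂ] π.V} (hS : ∀ g, Commute S (π.op g)) (g : G) :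
    Commute (star S) (π.op g) := by
  have := (hS g⁻¹).star_star
  rwa [star_op, inv_inv] at this

/-- The kernel of an operator commuting with an irreducible representation is trivial. -/
theorem IsIrreducible.eq_zero_of_mul_eq_zero (hπ : π.IsIrreducible) {S T : π.V →L[ℂ] π.V}
    (hS : ∀ g, Commute S (π.op g)) (h : S * T = 0) : S = 0 ∨ T = 0 := by
  rcases hπ.2 S.ker S.isClosed_ker (fun g x hx => by
    have := congrArg (fun A : π.V →L[ℂ] π.V => A x) (hS g)
    simp only [mul_apply_eq_comp, op_apply] at this
    simp_all) with hk | hk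
  · right
    ext x
    have : T x ∈ S.ker := congrArg (fun A : π.V →L[ℂ] π.V => A x) h
    rw [hk] at this
    simpa using this
  · left
    ext x
    have : x ∈ S.ker := hk ▸ Submodule.mem_top
    simpa using this

/-- Two distinct spectral points would give, by continuous functional calculus, two nonzero
commuting operators in the commutant with product zero. So the spectrum is a single point. -/
theorem IsIrreducible.exists_eq_smul_of_isSelfAdjoint (hπ : π.IsIrreducible)
    {S : π.V →L[ℂ] π.V} (hsa : IsSelfAdjoint S) (hS : ∀ g, Commute S (π.op g)) :
    ∃ c : ℝ, S = c • (1 : π.V →L[ℂ] π.V) := by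
  have := hπ.1
  obtain ⟨a, ha⟩ : (spectrum ℝ S).Nonempty := ContinuousFunctionalCalculus.spectrum_nonempty S hsa
  refine ⟨a, ?_⟩
  have hsub : ∀ b ∈ spectrum ℝ S, b = a := by
    intro b hb
    by_contra hab
    obtain ⟨r, hr, hr'⟩ : ∃ r : ℝ, 0 < r ∧ 2 * r ≤ |b - a| :=
      ⟨|b - a| / 2, by have := abs_pos.2 (sub_ne_zero.2 hab); positivity, by linarith⟩
    -- Tent of height and radius `r` at `c`; since `2 * r ≤ |b - a|`, the tents at `a` and `b` have
    -- product zero.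
    let f (c x : ℝ) : ℝ := max 0 (r - |x - c|)
    have hf (c : ℝ) : Continuous (f c) := by fun_prop
    have hne (c : ℝ) (hc : c ∈ spectrum ℝ S) : cfc (f c) S ≠ 0 := by
      intro h0
      have := cfc_map_spectrum (R := ℝ) (f c) S hsa (hf c).continuousOn
      rw [h0, spectrum.zero_eq] at this
      have hmem : f c c ∈ f c '' spectrum ℝ S := ⟨c, hc, rfl⟩
      rw [← this] at hmem
      have : max 0 r = 0 := by simpa [f] using hmem
      rw [max_eq_right hr.le] at this
      exact hr.ne' this
    have hmul : cfc (f a) S * cfc (f b) S = 0 := by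
      rw [← cfc_mul (f a) (f b) S (hf a).continuousOn (hf b).continuousOn]
      have : (fun x => f a x * f b x) = fun _ => (0 : ℝ) := by
        funext x
        have h1 : |b - a| ≤ |x - a| + |x - b| := by
          calc |b - a| = |(x - a) - (x - b)| := by congr 1; ring
            _ ≤ _ := abs_sub _ _
        rcases le_total r |x - a| with h | h
        · have : f a x = 0 := max_eq_left (by linarith)
          rw [this, zero_mul]
        · have : f b x = 0 := max_eq_left (by linarith)
          rw [this, mul_zero]
      rw [this, cfc_const_zero]
    rcases hπ.eq_zero_of_mul_eq_zero (fun g => (hS g).cfc_real (f a)) hmul with h | h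
    · exact hne a ha h
    · exact hne b hb h
  calc S = cfc (id : ℝ → ℝ) S := (cfc_id ℝ S).symm
    _ = cfc (fun _ : ℝ => a) S := cfc_congr fun b hb => hsub b hb
    _ = a • 1 := by rw [cfc_const a S, Algebra.algebraMap_eq_smul_one]

/-- Schur's lemma. -/
theorem IsIrreducible.exists_eq_smul (hπ : π.IsIrreducible)
    {S : π.V →L[ℂ] π.V} (hS : ∀ g, Commute S (π.op g)) :
    ∃ c : ℂ, S = c • (1 : π.V →L[ℂ] π.V) := by
  have hS' := commute_star hS
  have hre (g : G) : Commute (realPart S : π.V →L[ℂ] π.V) (π.op g) := by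
    rw [realPart_apply_coe]
    exact ((hS g).add_left (hS' g)).smul_left _
  have him (g : G) : Commute (imaginaryPart S : π.V →L[ℂ] π.V) (π.op g) := by
    rw [imaginaryPart_apply_coe]
    exact (((hS g).sub_left (hS' g)).smul_left _).smul_left _
  obtain ⟨a, ha⟩ := hπ.exists_eq_smul_of_isSelfAdjoint (realPart S).2 hre
  obtain ⟨b, hb⟩ := hπ.exists_eq_smul_of_isSelfAdjoint (imaginaryPart S).2 him
  refine ⟨a + Complex.I * b, ?_⟩
  conv_lhs => rw [← realPart_add_I_smul_imaginaryPart S, ha, hb]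
  rw [add_smul, mul_smul, Complex.coe_smul, Complex.coe_smul]

/-- A surjective intertwiner from a finite-dimensional irreducible representation to a nonzero
one can be rescaled to a unitary equivalence. -/
theorem IsIrreducible.equivalent_of_surjective (hπ : π.IsIrreducible) [Nontrivial σ.V]
    [FiniteDimensional ℂ π.V] (L : π.V →ₗ[ℂ] σ.V) (hL : Function.Surjective L)
    (h : ∀ g x, L (π.ρ g x) = σ.ρ g (L x)) : π.Equivalent σ := by
  let L' : π.V →L[ℂ] σ.V := LinearMap.toContinuousLinearMap L
  have hL' (x : π.V) : L' x = L x := rfl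
  -- `L* L` commutes with `G`, so it is a scalar `c`, positive since `L ≠ 0`; then `L / √c` is
  -- isometric.
  let S : π.V →L[ℂ] π.V := ContinuousLinearMap.adjoint L' ∘L L'
  have hinner (x y : π.V) : inner ℂ x (S y) = inner ℂ (L x) (L y) := by
    simp [S, ContinuousLinearMap.adjoint_inner_right, hL']
  have hS (g : G) : Commute S (π.op g) := by
    refine ContinuousLinearMap.ext fun x => ext_inner_left ℂ fun y => ?_
    obtain ⟨z, rfl⟩ := (π.ρ g).surjective y
    simp only [mul_apply_eq_comp, op_apply]
    rw [LinearIsometryEquiv.inner_map_map, hinner, hinner, h, h, LinearIsometryEquiv.inner_map_map]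
  have hsa : IsSelfAdjoint S := by
    rw [ContinuousLinearMap.isSelfAdjoint_iff_isSymmetric]
    intro x y
    change inner ℂ (S x) y = inner ℂ x (S y)
    rw [← inner_conj_symm, hinner, hinner, inner_conj_symm]
  obtain ⟨c, hc⟩ := hπ.exists_eq_smul_of_isSelfAdjoint hsa hS
  have hnorm (x : π.V) : ‖L x‖ ^ 2 = c * ‖x‖ ^ 2 := by
    have := hinner x x
    rw [hc] at this
    simp only [smul_apply, one_apply_eq_self] at this
    rw [← Complex.coe_smul, inner_smul_right, inner_self_eq_norm_sq_to_K,
      inner_self_eq_norm_sq_to_K] at this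
    exact Complex.ofReal_injective (by push_cast; simpa using this.symm)
  obtain ⟨z, hz⟩ := exists_ne (0 : σ.V)
  obtain ⟨x, rfl⟩ := hL z
  have hcpos : 0 < c := by
    have h1 : 0 < ‖L x‖ ^ 2 := by positivity
    rw [hnorm] at h1
    exact pos_of_mul_pos_left h1 (by positivity)
  have hs : (Real.sqrt c : ℝ) ≠ 0 := (Real.sqrt_pos.2 hcpos).ne'
  let U : π.V →ₗᵢ[ℂ] σ.V :=
    { toLinearMap := ((Real.sqrt c)⁻¹ : ℂ) • L
      norm_map' := fun y => by
        have hLy : ‖L y‖ = Real.sqrt c * ‖y‖ := by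
          rw [← Real.sqrt_sq (norm_nonneg (L y)), hnorm, Real.sqrt_mul hcpos.le,
            Real.sqrt_sq (norm_nonneg y)]
        simp [norm_smul, hLy, abs_of_pos (Real.sqrt_pos.2 hcpos), hs] }
  have hU (y : π.V) : U y = ((Real.sqrt c)⁻¹ : ℂ) • L y := rfl
  have hUg (g : G) (y : π.V) : U (π.ρ g y) = σ.ρ g (U y) := by
    rw [hU, hU, h, map_smul]
  have hsurj : Function.Surjective U := fun w => by
    obtain ⟨y, rfl⟩ := hL w
    refine ⟨(Real.sqrt c : ℂ) • y, ?_⟩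
    rw [hU, map_smul, inv_smul_smul₀ (Complex.ofReal_ne_zero.2 hs)]
  exact ⟨LinearIsometryEquiv.ofSurjective U hsurj, hUg⟩

/-- A nonzero intertwiner from a finite-dimensional irreducible representation to an irreducible
one can be rescaled to a unitary equivalence. -/
theorem IsIrreducible.equivalent_of_ne_zero (hπ : π.IsIrreducible) (hσ : σ.IsIrreducible)
    [FiniteDimensional ℂ π.V] (L : π.V →ₗ[ℂ] σ.V) (hL : L ≠ 0)
    (h : ∀ g x, L (π.ρ g x) = σ.ρ g (L x)) : π.Equivalent σ := by
  have := hσ.1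
  refine hπ.equivalent_of_surjective L (LinearMap.range_eq_top.1 ?_) h
  refine (hσ.2 (LinearMap.range L) (Submodule.closed_of_finiteDimensional _) ?_).resolve_left
    fun hr => hL (LinearMap.range_eq_bot.1 hr)
  rintro g _ ⟨y, rfl⟩
  exact ⟨π.ρ g y, h g y⟩

end UnitaryRep

/-! ### Finite-dimensionality of irreducible representations -/

namespace UnitaryRep

variable {G : Type u} [Group G] {π : UnitaryRep.{u, v} G}

section FiniteDimensional

open Polynomial
open scoped IsMulCommutative

variable (π) (A : Subgroup G)

/-- The extension of a representation to the group algebra of a subgroup. -/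
noncomputable def subgroupAlgHom : MonoidAlgebra ℂ A →ₐ[ℂ] (π.V →L[ℂ] π.V) :=
  MonoidAlgebra.lift ℂ (π.V →L[ℂ] π.V) A (π.op.comp A.subtype)

theorem subgroupAlgHom_single (a : A) (c : ℂ) :
    π.subgroupAlgHom A (MonoidAlgebra.single a c) = c • π.op a := by
  simp [subgroupAlgHom, MonoidAlgebra.lift_single]

variable [A.Normal]

/-- The conjugation action on the group algebra of a normal subgroup. -/
noncomputable def conjAlgHom (g : G) : MonoidAlgebra ℂ A →ₐ[ℂ] MonoidAlgebra ℂ A :=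
  MonoidAlgebra.mapDomainAlgHom ℂ ℂ (MulAut.conjNormal (H := A) g : A →* A)

variable {A} in
theorem conjAlgHom_mul (g h : G) (x : MonoidAlgebra ℂ A) :
    conjAlgHom A (g * h) x = conjAlgHom A g (conjAlgHom A h x) := by
  have : conjAlgHom A (g * h) = (conjAlgHom A g).comp (conjAlgHom A h) :=
    MonoidAlgebra.algHom_ext (fun a => by simp [conjAlgHom]) (by ext)
  rw [this]
  rfl

theorem conjAlgHom_of_mem [IsMulCommutative A] {a : G} (ha : a ∈ A) (x : MonoidAlgebra ℂ A) :
    conjAlgHom A a x = x := by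
  have : conjAlgHom A a = AlgHom.id ℂ _ := MonoidAlgebra.algHom_ext (fun b => by
    have : MulAut.conjNormal (H := A) a b = b := by
      have := IsMulCommutative.is_comm.comm (⟨a, ha⟩ : A) b
      exact Subtype.ext (mul_inv_eq_of_eq_mul (congrArg Subtype.val this))
    simp [conjAlgHom, this]) (by ext)
  rw [this]
  rfl

theorem subgroupAlgHom_conj (g : G) (x : MonoidAlgebra ℂ A) :
    π.subgroupAlgHom A (conjAlgHom A g x) * π.op g = π.op g * π.subgroupAlgHom A x := by
  induction x using MonoidAlgebra.induction_linear with
  | zero => simp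
  | add x y hx hy => simp only [map_add, add_mul, mul_add, hx, hy]
  | single a c =>
    have : conjAlgHom A g (MonoidAlgebra.single a c) =
        MonoidAlgebra.single (MulAut.conjNormal (H := A) g a) c := by simp [conjAlgHom]
    rw [this, subgroupAlgHom_single, subgroupAlgHom_single, smul_mul_assoc, mul_smul_comm,
      ← map_mul, ← map_mul]
    simp

/-- The polynomial whose roots are the conjugates of an element of the group algebra. -/
noncomputable def conjPolynomial [IsMulCommutative A] [Fintype (G ⧸ A)] (x : MonoidAlgebra ℂ A) :
    (MonoidAlgebra ℂ A)[X] :=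
  ∏ q : G ⧸ A, (X - C (conjAlgHom A q.out x))

theorem conjAlgHom_out [IsMulCommutative A] (g : G) (x : MonoidAlgebra ℂ A) :
    conjAlgHom A (g : G ⧸ A).out x = conjAlgHom A g x := by
  have h : g⁻¹ * (g : G ⧸ A).out ∈ A := QuotientGroup.eq.1 (QuotientGroup.out_eq' _).symm
  conv_lhs => rw [← mul_inv_cancel_left g (g : G ⧸ A).out, conjAlgHom_mul, conjAlgHom_of_mem A h]

/-- Conjugation by `g` permutes the factors through left multiplication on `G ⧸ A`, so the
coefficients are `G`-invariant. -/
theorem map_conjPolynomial [IsMulCommutative A] [Fintype (G ⧸ A)] (g : G)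
    (x : MonoidAlgebra ℂ A) :
    (conjPolynomial A x).map (conjAlgHom A g : MonoidAlgebra ℂ A →+* MonoidAlgebra ℂ A) =
      conjPolynomial A x := by
  rw [conjPolynomial, Polynomial.map_prod]
  refine Fintype.prod_equiv (Equiv.mulLeft (g : G ⧸ A)) _ _ fun q => ?_
  have : conjAlgHom A ((g : G ⧸ A) * q).out x = conjAlgHom A g (conjAlgHom A q.out x) := by
    conv_lhs => rw [← QuotientGroup.out_eq' q, ← QuotientGroup.mk_mul, conjAlgHom_out,
      conjAlgHom_mul]
  simp [this]

variable {π}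

/-- Each `x` is a root of its `conjPolynomial`, whose invariant coefficients act by scalars by
Schur. So the image of `ℂ[A]` is integral over `ℂ`; being a finitely generated algebra, it is
finite-dimensional. -/
theorem IsIrreducible.finite_subgroupAlgebra (hπ : π.IsIrreducible) [IsMulCommutative A]
    [A.FiniteIndex] [Group.FG A] :
    Module.Finite ℂ (MonoidAlgebra ℂ A ⧸ RingHom.ker (π.subgroupAlgHom A)) := by
  have : Finite (G ⧸ A) := Subgroup.finite_quotient_of_finiteIndex
  let _ : Fintype (G ⧸ A) := Fintype.ofFinite _
  set J := RingHom.ker (π.subgroupAlgHom A)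
  have : Algebra.FiniteType ℂ (MonoidAlgebra ℂ A) := MonoidAlgebra.finiteType_of_fg
  have : Algebra.FiniteType ℂ (MonoidAlgebra ℂ A ⧸ J) :=
    Algebra.FiniteType.of_surjective (Ideal.Quotient.mkₐ ℂ J) Ideal.Quotient.mk_surjective
  have : Algebra.IsIntegral ℂ (MonoidAlgebra ℂ A ⧸ J) := by
    refine ⟨fun y => ?_⟩
    obtain ⟨x, rfl⟩ := Ideal.Quotient.mk_surjective y
    have hmonic : (conjPolynomial A x).Monic :=
      monic_prod_of_monic _ _ fun q _ => monic_X_sub_C _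
    have hlift : (conjPolynomial A x).map (Ideal.Quotient.mk J) ∈
        lifts (algebraMap ℂ (MonoidAlgebra ℂ A ⧸ J)) := by
      rw [lifts_iff_coeff_lifts]
      intro k
      set y := (conjPolynomial A x).coeff k with hy
      have hyg (g : G) : conjAlgHom A g y = y := by
        conv_rhs => rw [hy, ← map_conjPolynomial A g x, coeff_map]
        rfl
      obtain ⟨c, hc⟩ := hπ.exists_eq_smul (S := π.subgroupAlgHom A y) fun g => by
        have := π.subgroupAlgHom_conj A g y
        rwa [hyg] at this
      refine ⟨c, ?_⟩
      rw [coeff_map, ← hy]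
      change Ideal.Quotient.mk J (algebraMap ℂ _ c) = Ideal.Quotient.mk J y
      rw [Ideal.Quotient.eq, RingHom.mem_ker, map_sub, AlgHom.commutes, hc,
        Algebra.algebraMap_eq_smul_one, sub_self]
    obtain ⟨p, hp, -, hpm⟩ := lifts_and_natDegree_eq_and_monic hlift (hmonic.map _)
    refine ⟨p, hpm, ?_⟩
    rw [eval₂_eq_eval_map, hp, eval_map, eval₂_hom]
    have : (conjPolynomial A x).eval x = 0 := by
      rw [conjPolynomial, eval_prod]
      refine Finset.prod_eq_zero (Finset.mem_univ ((1 : G) : G ⧸ A)) ?_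
      rw [conjAlgHom_out, conjAlgHom_of_mem A A.one_mem]
      simp
    rw [this, map_zero]
  exact Algebra.IsIntegral.finite

/-- The span of the orbit of `v ≠ 0` lies in the sum of finitely many translates of the
finite-dimensional space `ℂ[A] v`; it is therefore closed, and by irreducibility everything. -/
theorem IsIrreducible.finiteDimensional_of_subgroup (hπ : π.IsIrreducible) [IsMulCommutative A]
    [A.FiniteIndex] [Group.FG A] : FiniteDimensional ℂ π.V := by
  have := hπ.finite_subgroupAlgebra A
  have : Finite (G ⧸ A) := Subgroup.finite_quotient_of_finiteIndex
  obtain ⟨v, hv⟩ := (@exists_ne π.V hπ.1 0)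
  let E : Submodule ℂ (π.V →L[ℂ] π.V) := LinearMap.range (π.subgroupAlgHom A).toLinearMap
  have hE : FiniteDimensional ℂ E := by
    let θ := Ideal.Quotient.liftₐ (RingHom.ker (π.subgroupAlgHom A)) (π.subgroupAlgHom A)
      fun _ h => h
    have : E = LinearMap.range θ.toLinearMap := by
      ext S
      constructor
      · rintro ⟨x, rfl⟩
        exact ⟨Ideal.Quotient.mk _ x, rfl⟩
      · rintro ⟨y, rfl⟩
        obtain ⟨x, rfl⟩ := Ideal.Quotient.mk_surjective y
        exact ⟨x, rfl⟩
    rw [this]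
    infer_instance
  let W₀ : Submodule ℂ π.V := E.map (ContinuousLinearMap.apply ℂ π.V v).toLinearMap
  let W₁ : Submodule ℂ π.V := ⨆ q : G ⧸ A, W₀.map (π.op q.out).toLinearMap
  let W : Submodule ℂ π.V := Submodule.span ℂ (Set.range fun g : G => π.ρ g v)
  have hle : W ≤ W₁ := by
    refine Submodule.span_le.2 ?_
    rintro _ ⟨g, rfl⟩
    have ha : (g : G ⧸ A).out⁻¹ * g ∈ A := QuotientGroup.eq.1 (QuotientGroup.out_eq' _)
    refine Submodule.mem_iSup_of_mem (g : G ⧸ A) ⟨π.op ((g : G ⧸ A).out⁻¹ * g) v,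
      ⟨π.op ((g : G ⧸ A).out⁻¹ * g), ⟨MonoidAlgebra.single ⟨_, ha⟩ 1, ?_⟩, rfl⟩, ?_⟩
    · simpa using π.subgroupAlgHom_single A ⟨_, ha⟩ 1
    · change (π.op _ * π.op _) v = _
      rw [← map_mul, mul_inv_cancel_left]
      rfl
  have hWfin : FiniteDimensional ℂ W := Submodule.finiteDimensional_of_le hle
  rcases hπ.2 W (Submodule.closed_of_finiteDimensional _) (fun g x hx => by
    have : W ≤ W.comap (π.op g).toLinearMap := by
      refine Submodule.span_le.2 ?_
      rintro _ ⟨h, rfl⟩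
      refine Submodule.subset_span ⟨g * h, ?_⟩
      simp
    exact this hx) with h | h
  · exfalso
    have : v ∈ W := Submodule.subset_span ⟨1, by simp⟩
    rw [h] at this
    exact hv (by simpa using this)
  · rw [h] at hWfin
    exact Module.finite_def.2 (Module.Finite.iff_fg.1 hWfin)

end FiniteDimensional

theorem IsIrreducible.finiteDimensional (hπ : π.IsIrreducible) (hfg : Group.FG G)
    (hG : IsAlmostAbelian G) : FiniteDimensional ℂ π.V := by
  obtain ⟨A, _, hA, _⟩ := exists_normal_abelian_finiteIndex hG
  have : IsMulCommutative A := ⟨⟨fun a b => Subtype.ext (hA a a.2 b b.2)⟩⟩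
  have : Group.FG A := Subgroup.fg_of_index_ne_zero A
  exact hπ.finiteDimensional_of_subgroup A

/-! ### Burnside's theorem and the twisted trace -/

/-- The operators of a finite-dimensional irreducible representation span all operators. -/
theorem IsIrreducible.span_op_eq_top (hπ : π.IsIrreducible) [FiniteDimensional ℂ π.V] :
    Submodule.span ℂ (Set.range fun g => (π.op g).toLinearMap) = ⊤ := by
  let r : G →* Module.End ℂ π.V :=
    { toFun := fun g => (π.op g).toLinearMap
      map_one' := by ext; simp
      map_mul' := fun a b => by ext; simp }
  let θ : MonoidAlgebra ℂ G →ₐ[ℂ] Module.End ℂ π.V := MonoidAlgebra.lift ℂ _ G r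
  let S : Subalgebra ℂ (Module.End ℂ π.V) := θ.range
  let s (g : G) : S := ⟨r g, MonoidAlgebra.single g 1, by simp [θ, MonoidAlgebra.lift_single]⟩
  have hs (g : G) (x : π.V) : s g • x = π.ρ g x := rfl
  have : Nontrivial π.V := hπ.1
  have : IsSimpleModule S π.V := by
    refine (isSimpleModule_iff S π.V).2 { eq_bot_or_eq_top := fun P => ?_ }
    rcases hπ.2 (P.restrictScalars ℂ) (Submodule.closed_of_finiteDimensional _)
      (fun g x hx => P.smul_mem (s g) hx) with h | h
    · exact Or.inl ((Submodule.restrictScalars_eq_bot_iff _ _ _).1 h)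
    · exact Or.inr ((Submodule.restrictScalars_eq_top_iff _ _ _).1 h)
  -- By Schur the commutant consists of scalars, so every `ℂ`-linear `X` commutes with it, and the
  -- density theorem places `X` in `S`.
  have hscalar (c : Module.End S π.V) : ∃ a : ℂ, ∀ x, c x = a • x := by
    obtain ⟨a, ha⟩ := hπ.exists_eq_smul
      (S := LinearMap.toContinuousLinearMap (c.restrictScalars ℂ)) fun g => by
        ext x
        exact c.map_smul (s g) x
    exact ⟨a, fun x => congrArg (fun A : π.V →L[ℂ] π.V => A x) ha⟩
  have : Module.Finite (Module.End S π.V) π.V :=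
    Module.Finite.of_restrictScalars_finite ℂ (Module.End S π.V) π.V
  have hsurj := Module.Finite.toModuleEnd_moduleEnd_surjective (R := S) (M := π.V)
  have hmem (y : MonoidAlgebra ℂ G) :
      θ y ∈ Submodule.span ℂ (Set.range fun g => (π.op g).toLinearMap) := by
    induction y using MonoidAlgebra.induction_linear with
    | zero => simp
    | add x y hx hy =>
      rw [map_add]
      exact add_mem hx hy
    | single g c =>
      have : θ (MonoidAlgebra.single g c) = c • r g := by simp [θ, MonoidAlgebra.lift_single]
      rw [this]
      exact Submodule.smul_mem _ _ (Submodule.subset_span ⟨g, rfl⟩)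
  rw [eq_top_iff]
  rintro X -
  obtain ⟨⟨_, y, rfl⟩, hy⟩ := hsurj
    { toFun := X
      map_add' := X.map_add
      map_smul' := fun c x => by
        obtain ⟨a, ha⟩ := hscalar c
        change X (c x) = c (X x)
        rw [ha, ha, map_smul] }
  have hX : X = θ y := LinearMap.ext fun x => (LinearMap.congr_fun hy x).symm
  exact hX ▸ hmem y

/-- If every coset of `N` lies in a single `φ`-class, then `N` acts trivially in each irreducible
representation that is equivalent to its pullback along `φ`. -/
theorem IsIrreducible.op_eq_one_of_equivalent_comp (hπ : π.IsIrreducible)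
    [FiniteDimensional ℂ π.V] (φ : G →* G) (hfix : (UnitaryRep.comp φ π).Equivalent π) {n : G}
    (hn : ∀ x : G, ∃ γ : G, x * n = γ * x * (φ γ)⁻¹) : π.op n = 1 := by
  obtain ⟨T, hT⟩ := hfix
  let T' : π.V ≃ₗᵢ[ℂ] π.V := T.symm
  have hT' (g : G) (x : π.V) : T' (π.ρ g x) = π.ρ (φ g) (T' x) := by
    apply T.injective
    refine (T.apply_symm_apply _).trans ((hT g (T' x)).trans ?_).symm
    exact congrArg (π.ρ g) (T.apply_symm_apply x)
  let r (g : G) : Module.End ℂ π.V := (π.op g).toLinearMap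
  have hr (g h : G) : r (g * h) = r g * r h := by
    ext x
    simp [r]
  let t : Module.End ℂ π.V := T'.toLinearEquiv.toLinearMap
  have htr (g : G) : t * r g = r (φ g) * t := LinearMap.ext (hT' g)
  -- The function `x ↦ tr (t ρ(x))` is constant on `φ`-classes, by cyclicity of the trace.
  have htrace (x : G) : LinearMap.trace ℂ _ (t * (r x * r n)) = LinearMap.trace ℂ _ (t * r x) := by
    obtain ⟨γ, hγ⟩ := hn x
    rw [← hr, hγ, hr, ← mul_assoc, LinearMap.trace_mul_comm, hr, ← mul_assoc t, htr, ← mul_assoc,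
      ← mul_assoc, ← hr, inv_mul_cancel]
    congr 1
    ext x
    simp [r]
  have hX (X : Module.End ℂ π.V) :
      LinearMap.trace ℂ _ (X * (r n * t)) = LinearMap.trace ℂ _ (X * t) := by
    have hX : X ∈ Submodule.span ℂ (Set.range fun g => (π.op g).toLinearMap) := by
      rw [hπ.span_op_eq_top]
      trivial
    induction hX using Submodule.span_induction with
    | mem X hX =>
      obtain ⟨g, rfl⟩ := hX
      change LinearMap.trace ℂ _ (r g * (r n * t)) = LinearMap.trace ℂ _ (r g * t)
      rw [← mul_assoc, LinearMap.trace_mul_comm, htrace, LinearMap.trace_mul_comm]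
    | zero => simp
    | add X Y _ _ hX hY => rw [add_mul, add_mul, map_add, map_add, hX, hY]
    | smul c X _ hX => rw [smul_mul_assoc, smul_mul_assoc, map_smul, map_smul, hX]
  have hnt : r n * t = t := by
    rw [← sub_eq_zero]
    refine LinearMap.ext fun y => (Module.forall_dual_apply_eq_zero_iff ℂ _).1 fun f => ?_
    -- Testing against the rank-one operator `z ↦ f z • y` turns the trace into `f ((r n * t - t)
    -- y)`.
    have := hX (f.smulRight y)
    rw [← sub_eq_zero, ← map_sub, ← mul_sub] at this
    have hcomp : f.smulRight y * (r n * t - t) = (f ∘ₗ (r n * t - t)).smulRight y := rfl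
    rw [hcomp, LinearMap.trace_smulRight] at this
    exact this
  ext x
  obtain ⟨y, rfl⟩ := T'.surjective x
  exact LinearMap.congr_fun hnt y

end UnitaryRep

/-! ### Unitarization for finite groups -/

section Unitarization

open scoped MatrixOrder ComplexOrder

variable {H : Type u} [Group H]

/-- A homomorphism to unitary matrices as a unitary representation. -/
noncomputable def UnitaryRep.ofMatrix {n : Type v} [Fintype n] [DecidableEq n]
    (U : H →* unitary (Matrix n n ℂ)) : UnitaryRep.{u, v} H where
  V := EuclideanSpace ℂ n
  ρ := Unitary.linearIsometryEquiv.toMonoidHom.comp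
    { toFun := fun h => ⟨Matrix.toEuclideanCLM (n := n) (𝕜 := ℂ) (U h), Unitary.map_mem _ (U h).2⟩
      map_one' := by
        refine Subtype.ext ?_
        rw [map_one]
        exact map_one (Matrix.toEuclideanCLM (n := n) (𝕜 := ℂ))
      map_mul' := fun a b => by
        refine Subtype.ext ?_
        rw [map_mul]
        exact map_mul (Matrix.toEuclideanCLM (n := n) (𝕜 := ℂ)) _ _ }

theorem UnitaryRep.ofMatrix_apply {n : Type v} [Fintype n] [DecidableEq n]
    (U : H →* unitary (Matrix n n ℂ)) (h : H) (x : n → ℂ) :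
    (UnitaryRep.ofMatrix U).ρ h (WithLp.toLp 2 x : EuclideanSpace ℂ n) =
      (WithLp.toLp 2 ((U h : Matrix n n ℂ).mulVec x) : EuclideanSpace ℂ n) := rfl

variable [Finite H]

/-- Averaging: `P = ∑ r(h)* r(h)` is positive definite and invariant, and a factorization `P = Q* Q`
gives the conjugating matrix. -/
theorem exists_isUnit_conj_mem_unitary {n : Type*} [Fintype n] [DecidableEq n]
    (r : H →* Matrix n n ℂ) :
    ∃ Q : (Matrix n n ℂ)ˣ, ∀ h, Q * r h * (↑Q⁻¹ : Matrix n n ℂ) ∈ unitary (Matrix n n ℂ) := by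
  let _ : Fintype H := Fintype.ofFinite H
  let P : Matrix n n ℂ := ∑ h, star (r h) * r h
  have hunit (h : H) : IsUnit (r h) := (Group.isUnit h).map r
  have hP : P.PosDef := Matrix.posDef_sum Finset.univ_nonempty fun h _ =>
    Matrix.PosDef.conjTranspose_mul_self _ (Matrix.mulVec_injective_iff_isUnit.2 (hunit h))
  have hPinv (h : H) : star (r h) * P * r h = P := by
    simp only [P, Finset.mul_sum, Finset.sum_mul]
    refine Fintype.sum_equiv (Equiv.mulRight h) _ _ fun k => ?_
    simp [mul_assoc]
  obtain ⟨Q, hQ⟩ := CStarAlgebra.nonneg_iff_eq_star_mul_self.1 hP.posSemidef.nonneg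
  have hQu : IsUnit Q := by
    have := hP.isUnit
    rw [hQ, Matrix.isUnit_iff_isUnit_det, Matrix.det_mul] at this
    exact (Matrix.isUnit_iff_isUnit_det _).2 (isUnit_of_mul_isUnit_right this)
  obtain ⟨Q, rfl⟩ := hQu
  refine ⟨Q, fun h => ?_⟩
  have hu : IsUnit ((Q : Matrix n n ℂ) * r h * (↑Q⁻¹ : Matrix n n ℂ)) :=
    (Q.isUnit.mul (hunit h)).mul (Units.isUnit _)
  refine hu.mem_unitary_of_star_mul_self ?_
  calc _ = star (↑Q⁻¹ : Matrix n n ℂ) * (star (r h) * (star (Q : Matrix n n ℂ) * Q) * r h) * ↑Q⁻¹ := by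
        simp only [star_mul, mul_assoc]
    _ = star (Q * (↑Q⁻¹ : Matrix n n ℂ)) * (Q * ↑Q⁻¹) := by
        rw [← hQ, hPinv, hQ]
        simp only [star_mul, mul_assoc]
    _ = 1 := by simp

/-- Every matrix representation of a finite group is unitarizable. -/
theorem exists_unitaryRep_of_matrixRep {n : Type v} [Fintype n] [DecidableEq n]
    (r : H →* Matrix n n ℂ) :
    ∃ (π : UnitaryRep.{u, v} H) (L : (n → ℂ) ≃ₗ[ℂ] π.V),
      ∀ h x, L ((r h).mulVec x) = π.ρ h (L x) := by
  obtain ⟨Q, hQ⟩ := exists_isUnit_conj_mem_unitary r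
  let U : H →* unitary (Matrix n n ℂ) :=
    { toFun := fun h => ⟨Q * r h * (↑Q⁻¹ : Matrix n n ℂ), hQ h⟩
      map_one' := Subtype.ext (by simp)
      map_mul' := fun a b => Subtype.ext (by simp [mul_assoc]) }
  let L : (n → ℂ) ≃ₗ[ℂ] EuclideanSpace ℂ n :=
    (LinearEquiv.ofBijective (Matrix.mulVecLin (Q : Matrix n n ℂ))
      ⟨Matrix.mulVec_injective_iff_isUnit.2 Q.isUnit,
        Matrix.mulVec_surjective_iff_isUnit.2 Q.isUnit⟩).trans
      (WithLp.linearEquiv 2 ℂ (n → ℂ)).symm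
  have hL (x : n → ℂ) : L x = WithLp.toLp 2 ((Q : Matrix n n ℂ).mulVec x) := rfl
  refine ⟨UnitaryRep.ofMatrix U, L, fun h x => ?_⟩
  have hU : (U h : Matrix n n ℂ) = Q * r h * (↑Q⁻¹ : Matrix n n ℂ) := rfl
  have key : (Q : Matrix n n ℂ).mulVec ((r h).mulVec x) =
      (U h : Matrix n n ℂ).mulVec ((Q : Matrix n n ℂ).mulVec x) := by
    rw [hU, Matrix.mulVec_mulVec, Matrix.mulVec_mulVec, mul_assoc _ _ (Q : Matrix n n ℂ),
      Units.inv_mul, mul_one]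
  exact ((hL _).trans (congrArg (WithLp.toLp 2) key)).trans
    (UnitaryRep.ofMatrix_apply U h _).symm

end Unitarization

/-! ### The unitary dual of a finite group -/

section FiniteGroup

variable {H : Type u} [Group H] {I : Type*} {ι : I → Type v}
  [∀ i, Fintype (ι i)] [∀ i, DecidableEq (ι i)]
  {e : MonoidAlgebra ℂ H ≃ₐ[ℂ] Π i, Matrix (ι i) (ι i) ℂ}

/-- A unitary representation that is linearly equivalent to a block of the group algebra. -/
def UnitaryRep.RealizesBlock (e : MonoidAlgebra ℂ H ≃ₐ[ℂ] Π i, Matrix (ι i) (ι i) ℂ) (i : I)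
    (π : UnitaryRep.{u, v} H) (L : (ι i → ℂ) ≃ₗ[ℂ] π.V) : Prop :=
  ∀ h x, L ((blockRep e i h).mulVec x) = π.ρ h (L x)

namespace UnitaryRep.RealizesBlock

variable {i : I} {π : UnitaryRep.{u, v} H} {L : (ι i → ℂ) ≃ₗ[ℂ] π.V}

theorem finiteDimensional (_ : RealizesBlock e i π L) : FiniteDimensional ℂ π.V :=
  Module.Finite.equiv L

/-- The group operators span all matrices, so every nonzero vector is cyclic. -/
theorem isIrreducible [Nonempty (ι i)] (h : RealizesBlock e i π L) : π.IsIrreducible := by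
  refine ⟨L.symm.toEquiv.nontrivial, fun W _ hW => ?_⟩
  rw [or_iff_not_imp_left]
  intro hne
  obtain ⟨w, hw, hw0⟩ := (Submodule.ne_bot_iff _).1 hne
  obtain ⟨v, rfl⟩ := L.surjective w
  have hv : v ≠ 0 := fun h0 => hw0 (by simp [h0])
  have key (X : Matrix (ι i) (ι i) ℂ) : L (X.mulVec v) ∈ W := by
    let f : Matrix (ι i) (ι i) ℂ →ₗ[ℂ] (π.V ⧸ W) :=
      W.mkQ ∘ₗ L.toLinearMap ∘ₗ
        { toFun := fun X => X.mulVec v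
          map_add' := fun X Y => Matrix.add_mulVec X Y v
          map_smul' := fun c X => Matrix.smul_mulVec c X v }
    have hf : f = 0 := matrix_linearMap_ext e i fun x => by
      refine (Submodule.Quotient.mk_eq_zero W).2 ?_
      change L ((blockRep e i x).mulVec v) ∈ W
      rw [h]
      exact hW x _ hw
    exact (Submodule.Quotient.mk_eq_zero W).1 (LinearMap.congr_fun hf X)
  obtain ⟨j, hj⟩ := Function.ne_iff.1 hv
  refine eq_top_iff.2 fun z _ => ?_
  obtain ⟨y, rfl⟩ := L.surjective z
  have := key (Matrix.vecMulVec y (Pi.single j (v j)⁻¹))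
  rw [Matrix.vecMulVec_mulVec] at this
  simpa [show v j ≠ 0 from hj] using this

/-- A nonzero intertwiner is invertible, and Schur for `π` rescales it to a unitary. Only
surjectivity is used on the target, as the pullback is not known to be irreducible at that point. -/
theorem equivalent_comp_iff [Nonempty (ι i)] (h : RealizesBlock e i π L) (φ : H →* H) :
    (UnitaryRep.comp φ π).Equivalent π ↔ blockIntertwiners e φ i ≠ ⊥ := by
  have := h.finiteDimensional
  have hirr := h.isIrreducible
  have : Nontrivial π.V := hirr.1
  constructor
  · rintro ⟨T, hT⟩
    let T' : π.V ≃ₗᵢ[ℂ] π.V := T.symm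
    have hT' (g : H) (x : π.V) : T' (π.ρ g x) = π.ρ (φ g) (T' x) := by
      apply T.injective
      refine (T.apply_symm_apply _).trans ((hT g (T' x)).trans ?_).symm
      exact congrArg (π.ρ g) (T.apply_symm_apply x)
    let K : (ι i → ℂ) ≃ₗ[ℂ] (ι i → ℂ) := (L.trans T'.toLinearEquiv).trans L.symm
    have hK (x : ι i → ℂ) : L (K x) = T' (L x) := L.apply_symm_apply _
    refine (Submodule.ne_bot_iff _).2 ⟨LinearMap.toMatrix' K.toLinearMap, fun g => ?_, ?_⟩
    · apply Matrix.toLin'.injective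
      rw [Matrix.toLin'_mul, Matrix.toLin'_mul, Matrix.toLin'_toMatrix']
      refine LinearMap.ext fun x => L.injective ?_
      change L (K ((blockRep e i g).mulVec x)) = L ((blockRep e i (φ g)).mulVec (K x))
      rw [hK, h, h, hK, hT']
    · intro h0
      have : K.toLinearMap = 0 := by simpa using h0
      have := LinearMap.congr_fun this (fun _ => 1)
      have h1 : (fun _ : ι i => (1 : ℂ)) = 0 := K.injective (by simpa using this)
      exact one_ne_zero (congrFun h1 (Classical.arbitrary _))
  · intro hne
    obtain ⟨T, hT, h0⟩ := (Submodule.ne_bot_iff _).1 hne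
    have hu := isUnit_of_mem_blockIntertwiners hT h0
    let K : π.V →ₗ[ℂ] π.V := L.toLinearMap ∘ₗ T.mulVecLin ∘ₗ L.symm.toLinearMap
    have hKs : Function.Surjective K :=
      L.surjective.comp ((Matrix.mulVec_surjective_iff_isUnit.2 hu).comp L.symm.surjective)
    have hK (g : H) (x : π.V) : K (π.ρ g x) = π.ρ (φ g) (K x) := by
      obtain ⟨y, rfl⟩ := L.surjective x
      change L (T.mulVec (L.symm (π.ρ g (L y)))) = π.ρ (φ g) (L (T.mulVec (L.symm (L y))))
      rw [← h, ← h, L.symm_apply_apply, L.symm_apply_apply, Matrix.mulVec_mulVec,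
        Matrix.mulVec_mulVec, hT g]
    have : Nontrivial (UnitaryRep.comp φ π).V := hirr.1
    exact (UnitaryRep.setoid H).symm
      (hirr.equivalent_of_surjective (σ := UnitaryRep.comp φ π) K hKs hK)

/-- An equivalence would intertwine the actions of the whole product; the unit of block `i` is the
identity on one side and, if `i ≠ j`, zero on the other. -/
theorem eq_of_equivalent {j : I} [Nonempty (ι i)] {σ : UnitaryRep.{u, v} H}
    {M : (ι j → ℂ) ≃ₗ[ℂ] σ.V} (h : RealizesBlock e i π L) (h' : RealizesBlock e j σ M)
    (heq : π.Equivalent σ) : i = j := by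
  classical
  obtain ⟨T, hT⟩ := heq
  by_contra hij
  let K : (ι i → ℂ) ≃ₗ[ℂ] (ι j → ℂ) := (L.trans T.toLinearEquiv).trans M.symm
  have hK (x : ι i → ℂ) : M (K x) = T (L x) := M.apply_symm_apply _
  have key (X : Π i, Matrix (ι i) (ι i) ℂ) :
      K ((X i).mulVec fun _ => 1) = (X j).mulVec (K fun _ => 1) := by
    let f : (Π i, Matrix (ι i) (ι i) ℂ) →ₗ[ℂ] (ι j → ℂ) :=
      { toFun := fun X => K ((X i).mulVec fun _ => 1)
        map_add' := fun X Y => by simp [Matrix.add_mulVec]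
        map_smul' := fun c X => by simp [Matrix.smul_mulVec] }
    let g : (Π i, Matrix (ι i) (ι i) ℂ) →ₗ[ℂ] (ι j → ℂ) :=
      { toFun := fun X => (X j).mulVec (K fun _ => 1)
        map_add' := fun X Y => by simp [Matrix.add_mulVec]
        map_smul' := fun c X => by simp [Matrix.smul_mulVec] }
    have : f = g := pi_matrix_linearMap_ext e fun x => M.injective <| by
      change M (K ((blockRep e i x).mulVec _)) = M ((blockRep e j x).mulVec (K _))
      rw [hK, h, h', hK, hT]
    exact LinearMap.congr_fun this X
  have := key (Pi.single i 1)
  rw [Pi.single_eq_same, Pi.single_eq_of_ne (Ne.symm hij), Matrix.one_mulVec,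
    Matrix.zero_mulVec] at this
  have h1 : (fun _ : ι i => (1 : ℂ)) = 0 := K.injective (by simpa using this)
  exact one_ne_zero (congrFun h1 (Classical.arbitrary _))

end UnitaryRep.RealizesBlock

/-- Every irreducible representation occurs in some block of the group algebra. -/
theorem UnitaryRep.IsIrreducible.exists_block [Fintype I] {σ : UnitaryRep.{u, v} H}
    (hσ : σ.IsIrreducible) :
    ∃ i, ∃ K : (ι i → ℂ) →ₗ[ℂ] σ.V, K ≠ 0 ∧
      ∀ h x, K ((blockRep e i h).mulVec x) = σ.ρ h (K x) := by
  classical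
  have := hσ.1
  let θ : MonoidAlgebra ℂ H →ₐ[ℂ] (σ.V →L[ℂ] σ.V) := MonoidAlgebra.lift ℂ _ H σ.op
  have hθ (h : H) : θ (MonoidAlgebra.of ℂ H h) = σ.op h := by simp [θ]
  obtain ⟨v, hv⟩ := exists_ne (0 : σ.V)
  -- The diagonal matrix units of all blocks sum to 1, so one of them does not kill `v`; column `j`
  -- of block `i`, applied to `v`, then gives `K`.
  obtain ⟨i, j, hij⟩ : ∃ i, ∃ j : ι i,
      θ (e.symm (Pi.single i (Matrix.single j j 1))) v ≠ 0 := by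
    by_contra! hcon
    have hone (i : I) : ∑ j : ι i, Matrix.single j j (1 : ℂ) = 1 := by
      simp [Matrix.sum_single_one]
    have : (1 : Π i, Matrix (ι i) (ι i) ℂ) =
        ∑ i, ∑ j : ι i, Pi.single i (Matrix.single j j (1 : ℂ)) := by
      rw [← Finset.univ_sum_single (1 : Π i, Matrix (ι i) (ι i) ℂ)]
      refine Finset.sum_congr rfl fun i _ => ?_
      rw [Pi.one_apply, ← hone]
      exact map_sum (AddMonoidHom.single (fun i => Matrix (ι i) (ι i) ℂ) i) _ _
    have h1 : θ (e.symm 1) v = 0 := by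
      rw [this]
      simp only [map_sum, sum_apply]
      exact Finset.sum_eq_zero fun i _ => Finset.sum_eq_zero fun j _ => hcon i j
    exact hv (by simpa using h1)
  let K : (ι i → ℂ) →ₗ[ℂ] σ.V :=
    { toFun := fun w => θ (e.symm (Pi.single i (Matrix.vecMulVec w (Pi.single j 1)))) v
      map_add' := fun x y => by
        rw [Matrix.add_vecMulVec, Pi.single_add, map_add, map_add]
        rfl
      map_smul' := fun c x => by
        rw [Matrix.smul_vecMulVec, Pi.single_smul, map_smul, map_smul]
        rfl }
  have hKa (w) : K w = θ (e.symm (Pi.single i (Matrix.vecMulVec w (Pi.single j 1)))) v := rfl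
  refine ⟨i, K, fun h0 => hij ?_, fun h x => ?_⟩
  · have := LinearMap.congr_fun h0 (Pi.single j 1)
    rw [hKa] at this
    simpa [← Matrix.single_eq_single_vecMulVec_single] using this
  · rw [hKa, ← Matrix.mul_vecMulVec, symm_single_blockRep_mul, map_mul, hθ]
    rfl

/-- The unitarized blocks list the unitary dual without repetition, and a block is fixed exactly
when it has a nonzero intertwiner. -/
theorem reidemeisterNumber_eq_of_finite [Finite H] (φ : H →* H) :
    reidemeisterNumber φ = numDualFixedPoints.{u, v} φ := by
  classical
  obtain ⟨n, ι, _, _, _, ⟨e⟩⟩ := exists_groupAlgebra_algEquiv_pi_matrix.{u, v} H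
  choose π L hπ using fun i => exists_unitaryRep_of_matrixRep (blockRep e i)
  have hreal (i : Fin n) : UnitaryRep.RealizesBlock e i (π i) (L i) := hπ i
  have himage : dualFixedPoints.{u, v} φ =
      (fun i => (⟦π i⟧ : UnitaryRepClass.{u, v} H)) '' {i | blockIntertwiners e φ i ≠ ⊥} := by
    ext c
    constructor
    · rintro ⟨⟨σ, hσ, rfl⟩, hfix⟩
      obtain ⟨i, K, hK0, hK⟩ := hσ.exists_block (e := e)
      have := (hreal i).finiteDimensional
      have hiσ : (π i).Equivalent σ := by
        refine (hreal i).isIrreducible.equivalent_of_ne_zero hσ (K ∘ₗ (L i).symm.toLinearMap)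
          (fun h0 => hK0 ?_) fun g x => ?_
        · refine LinearMap.ext fun x => ?_
          simpa using LinearMap.congr_fun h0 (L i x)
        · obtain ⟨y, rfl⟩ := (L i).surjective x
          simp [← hπ, hK]
      have hcls : (⟦π i⟧ : UnitaryRepClass.{u, v} H) = ⟦σ⟧ := Quotient.sound hiσ
      refine ⟨i, ((hreal i).equivalent_comp_iff φ).1 ?_, hcls⟩
      rw [← hcls] at hfix
      exact Quotient.exact hfix
    · rintro ⟨i, hi, rfl⟩
      exact ⟨⟨π i, (hreal i).isIrreducible, rfl⟩,
        Quotient.sound (((hreal i).equivalent_comp_iff φ).2 hi)⟩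
  have hinj : Function.Injective (fun i => (⟦π i⟧ : UnitaryRepClass.{u, v} H)) := fun i j hij =>
    (hreal i).eq_of_equivalent (hreal j) (Quotient.exact hij)
  rw [numDualFixedPoints, himage, hinj.encard_image, reidemeisterNumber, Set.encard,
    ENat.card_eq_coe_natCard, ENat.card_eq_coe_natCard, card_reidemeisterClass e φ]
  rfl

end FiniteGroup

/-! ### Inflation from a quotient and conclusion -/

namespace UnitaryRep

variable {G : Type u} [Group G] (N : Subgroup G) [N.Normal]

/-- The inflation of a representation of a quotient group. -/
def inflate (π : UnitaryRep.{u, v} (G ⧸ N)) : UnitaryRep.{u, v} G where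
  V := π.V
  ρ := π.ρ.comp (QuotientGroup.mk' N)

variable {N} {π σ : UnitaryRep.{u, v} (G ⧸ N)}

theorem inflate_equivalent_iff : (inflate N π).Equivalent (inflate N σ) ↔ π.Equivalent σ := by
  constructor
  · rintro ⟨T, hT⟩
    refine ⟨T, fun g x => ?_⟩
    obtain ⟨g, rfl⟩ := QuotientGroup.mk_surjective g
    exact hT g x
  · rintro ⟨T, hT⟩
    exact ⟨T, fun g x => hT g x⟩

theorem inflate_isIrreducible_iff : (inflate N π).IsIrreducible ↔ π.IsIrreducible := by
  refine and_congr Iff.rfl (forall_congr' fun W => forall_congr' fun _ => ?_)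
  refine imp_congr_left ⟨fun h g x hx => ?_, fun h g x hx => h g x hx⟩
  obtain ⟨g, rfl⟩ := QuotientGroup.mk_surjective g
  exact h g x hx

theorem exists_inflate_eq (τ : UnitaryRep.{u, v} G) (h : ∀ n ∈ N, τ.ρ n = 1) :
    ∃ π : UnitaryRep.{u, v} (G ⧸ N), inflate N π = τ :=
  ⟨⟨τ.V, QuotientGroup.lift N τ.ρ h⟩, rfl⟩

end UnitaryRep

/-- Inflation is injective on classes, preserves irreducibility and commutes with pullback; `hN`
makes every fixed point an inflation. -/
theorem numDualFixedPoints_quotient {G : Type u} [Group G] (φ : G →* G) (N : Subgroup G)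
    [N.Normal] (hφ : N ≤ N.comap φ)
    (hN : ∀ τ : UnitaryRep.{u, v} G, τ.IsIrreducible → (UnitaryRep.comp φ τ).Equivalent τ →
      ∀ n ∈ N, τ.ρ n = 1) :
    numDualFixedPoints.{u, v} φ = numDualFixedPoints.{u, v} (QuotientGroup.map N N φ hφ) := by
  let f : UnitaryRepClass.{u, v} (G ⧸ N) → UnitaryRepClass.{u, v} G :=
    Quotient.map (UnitaryRep.inflate N) fun _ _ h => UnitaryRep.inflate_equivalent_iff.2 h
  have hf : Function.Injective f := by
    intro a b
    induction a using Quotient.inductionOn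
    induction b using Quotient.inductionOn
    exact fun h => Quotient.sound (UnitaryRep.inflate_equivalent_iff.1 (Quotient.exact h))
  have himage : dualFixedPoints.{u, v} φ =
      f '' dualFixedPoints.{u, v} (QuotientGroup.map N N φ hφ) := by
    ext c
    constructor
    · rintro ⟨⟨τ, hτ, rfl⟩, hfix⟩
      have hfix' : (UnitaryRep.comp φ τ).Equivalent τ := Quotient.exact hfix
      obtain ⟨π, rfl⟩ := τ.exists_inflate_eq (hN τ hτ hfix')
      exact ⟨⟦π⟧, ⟨⟨π, UnitaryRep.inflate_isIrreducible_iff.1 hτ, rfl⟩,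
        Quotient.sound (UnitaryRep.inflate_equivalent_iff.1 hfix')⟩, rfl⟩
    · rintro ⟨_, ⟨⟨π, hπ, rfl⟩, hfix⟩, rfl⟩
      exact ⟨⟨_, UnitaryRep.inflate_isIrreducible_iff.2 hπ, rfl⟩,
        Quotient.sound (UnitaryRep.inflate_equivalent_iff.2 (Quotient.exact hfix))⟩
  rw [numDualFixedPoints, himage, hf.encard_image, numDualFixedPoints]

theorem theorem55 {G : Type u} [Group G] (hfg : Group.FG G) (hG : IsAlmostAbelian G)
    (φ : G →* G) (hR : reidemeisterNumber φ ≠ ⊤) :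
    reidemeisterNumber φ = numDualFixedPoints.{u, v} φ := by
  have : Finite (ReidemeisterClass φ) := ENat.card_lt_top.1 (lt_top_iff_ne_top.2 hR)
  obtain ⟨N, _, _, hφ, hN⟩ := exists_finiteIndex_separating φ hfg hG
  have : Finite (G ⧸ N) := Subgroup.finite_quotient_of_finiteIndex
  rw [reidemeisterNumber_quotient φ N hφ hN, reidemeisterNumber_eq_of_finite.{u, v}]
  refine (numDualFixedPoints_quotient φ N hφ fun τ hτ hfix n hn => ?_).symm
  have := hτ.finiteDimensional hfg hG
  have h := hτ.op_eq_one_of_equivalent_comp φ hfix fun x => hN x n hn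
  ext x
  exact congrArg (fun A : τ.V →L[ℂ] τ.V => A x) h
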